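/- For a finite simple graph $G$, let $K_e(G)$ be its edge-clique graph: its vertices are the edges of $G$, and two distinct edges of $G$ are adjacent in $K_e(G)$ when some clique of $G$ contains the endpoints of both. For $n\in\mathbb{N}$, let $cp(n)$ be the cocktail party graph, that is, the complement of a perfect matching on $2n$ vertices. The rankwidth of a finite graph $H$ with vertex set $V$ is defined as follows. A rank-decomposition of $H$ is a pair $(T,L)$, where $T$ is a finite tree of maximum degree at most $3$ and $L$ is a bijection from $V$ to the set of leaves (vertices of degree one) of $T$. Removing an edge $e$ of $T$ splits the leaves into two parts, and so induces a partition $(A_e, V\setminus A_e)$ of $V$. The width of $(T,L)$ is the maximum, over the edges $e$ of $T$, of the rank over $\mathrm{GF}(2)$ of the $A_e\times(V\setminus A_e)$ submatrix of the adjacency matrix of $H$. The rankwidth of $H$ is the minimum width of a rank-decomposition of $H$; it is $0$ if $|V|\le 1$. Theorem. The class of edge-clique graphs of cocktail party graphs has unbounded rankwidth: there is no constant $k$ such that for every $n\in\mathbb{N}$ the rankwidth of $K_e(cp(n))$ is at most $k$. -/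

import Mathlib

/-- The matching with `n` edges on the `2n` vertices `Fin n × Bool`: the partner of `(i, b)` is
`(i, !b)`. -/
def matchingGraph (n : ℕ) : SimpleGraph (Fin n × Bool) where
  Adj u v := u.1 = v.1 ∧ u.2 ≠ v.2
  symm := ⟨fun _ _ h => ⟨h.1.symm, h.2.symm⟩⟩
  loopless := ⟨fun _ h => h.2 rfl⟩

instance (n : ℕ) : DecidableRel (matchingGraph n).Adj :=
  fun u v => inferInstanceAs (Decidable (u.1 = v.1 ∧ u.2 ≠ v.2))

/-- The cocktail party graph `cp(n)`: the complement of a matching with `2n` vertices. -/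
abbrev cocktailParty (n : ℕ) : SimpleGraph (Fin n × Bool) := (matchingGraph n)ᶜ

/-- The edge-clique graph `K_e(G)`: its vertices are the edges of `G`, and two distinct edges are
adjacent when some clique of `G` contains (the endpoints of) both. -/
def edgeCliqueGraph {V : Type*} (G : SimpleGraph V) : SimpleGraph G.edgeSet where
  Adj e f := e ≠ f ∧ ∃ s : Set V, G.IsClique s ∧
    (∀ v ∈ (e : Sym2 V), v ∈ s) ∧ (∀ v ∈ (f : Sym2 V), v ∈ s)
  symm := ⟨fun _ _ h => ⟨h.1.symm, h.2.imp fun _ hs => ⟨hs.1, hs.2.2, hs.2.1⟩⟩⟩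
  loopless := ⟨fun _ h => h.1 rfl⟩

open scoped Classical in
/-- The cut-rank of a vertex set `S`: the rank over `GF(2)` of the `S × Sᶜ` submatrix of the
adjacency matrix. -/
noncomputable def cutRank {V : Type*} [Fintype V] (G : SimpleGraph V) (S : Set V) : ℕ :=
  ((G.adjMatrix (ZMod 2)).submatrix (Subtype.val : S → V) (Subtype.val : ↥Sᶜ → V)).rank

/-- A rank-decomposition of a vertex set `V`: a finite tree of maximum degree at most three,
together with a bijection from `V` to the set of its leaves (the nodes of degree one). -/
structure RankDecomposition (V : Type*) where
  Node : Type
  [fintypeNode : Fintype Node]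
  tree : SimpleGraph Node
  [decAdj : DecidableRel tree.Adj]
  isTree : tree.IsTree
  degree_le : ∀ t, tree.degree t ≤ 3
  leaf : V ≃ {t : Node // tree.degree t = 1}

namespace RankDecomposition

attribute [instance] fintypeNode decAdj

variable {V : Type*}

/-- The vertices of `V` whose leaves lie in the component of `a` once the tree edge `ab` is
removed. -/
def side (D : RankDecomposition V) (a b : D.Node) : Set V :=
  {v | (D.tree.deleteEdges {s(a, b)}).Reachable a (D.leaf v).1}

open scoped Classical in
/-- The width of a rank-decomposition: the maximum, over all edges `ab` of the tree, of the
cut-rank of the partition of `V` induced by removing `ab` (and `0` if the tree has no edge). -/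
noncomputable def width [Fintype V] (D : RankDecomposition V) (G : SimpleGraph V) : ℕ :=
  Finset.univ.sup fun d : D.tree.Dart => cutRank G (D.side d.fst d.snd)

end RankDecomposition

/-- The rankwidth of a finite graph: the minimum width of a rank-decomposition. If the graph has
exactly one vertex there is none, and the rankwidth is `0`, as usual (`sInf ∅ = 0` in `ℕ`). -/
noncomputable def rankWidth {V : Type*} [Fintype V] (G : SimpleGraph V) : ℕ :=
  sInf {w : ℕ | ∃ D : RankDecomposition V, D.width G = w}

/-! In `cocktailParty (N + 1)` take the star of `N` edges `spoke i` and the edges `chord i j`. A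
clique uses at most one vertex of each matched pair, so a chord meets every spoke in a clique except
the two with its own indices. Any rank-decomposition with `3 * m ≤ N` has a tree edge with at least
`m` spokes on each side (`exists_balanced`). Let `X` and `Y` index `m` spokes on either side. The
position of the chords between `X` and `Y` forces, across the cut, an `m × m` submatrix `J - I`,
with `J` the all-ones matrix (`le_cutRank_of_spokes`). For even `m` this is invertible over GF(2),
so the width is at least `m`, which is arbitrary. -/

/-! ### Cut-rank from a complemented identity matrix. -/

open scoped Classical in
/-- If `x` and `y` index rows and columns of the cut `(S, Sᶜ)` on which the adjacency matrix is the
complement of an identity matrix of even size, then the cut-rank is at least that size. -/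
theorem card_le_cutRank {V κ : Type*} [Fintype V] [Fintype κ] (G : SimpleGraph V) (S : Set V)
    (hκ : Even (Fintype.card κ)) (x y : κ → V) (hx : ∀ a, x a ∈ S) (hy : ∀ a, y a ∉ S)
    (hadj : ∀ a b, G.Adj (x a) (y b) ↔ a ≠ b) : Fintype.card κ ≤ cutRank G S := by
  let M : Matrix κ κ (ZMod 2) := Matrix.of fun a b => if a = b then 0 else 1
  have hM : M = (Matrix.of fun _ _ => 1) - 1 := by
    ext a b
    by_cases h : a = b <;> simp [M, h]
  -- `J * J` is the size times `J`; this is where evenness enters. Hence `J - I` is its own inverse.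
  have hJ : (Matrix.of fun _ _ => 1 : Matrix κ κ (ZMod 2)) * (Matrix.of fun _ _ => 1) = 0 := by
    ext a b
    have : ((Fintype.card κ : ℕ) : ZMod 2) = 0 := by
      rw [ZMod.natCast_eq_zero_iff]; exact hκ.two_dvd
    simp [Matrix.mul_apply, this]
  have hMM : M * M = 1 := by
    have h2 : (2 : Matrix κ κ (ZMod 2)) = 0 := by
      have : (2 : ZMod 2) = 0 := by decide
      ext a b
      rw [← Matrix.diagonal_ofNat]
      simp [Matrix.diagonal, this]
    have : M * M = (Matrix.of fun _ _ => 1) * (Matrix.of fun _ _ => 1)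
        - 2 * (Matrix.of fun _ _ => 1) + 1 := by
      rw [hM]; noncomm_ring
    rw [this, hJ, h2]; simp
  rw [← Matrix.rank_of_isUnit M (IsUnit.of_mul_eq_one _ hMM)]
  have : M = ((G.adjMatrix (ZMod 2)).submatrix (Subtype.val : S → V)
      (Subtype.val : ↥Sᶜ → V)).submatrix (fun a => ⟨x a, hx a⟩) (fun b => ⟨y b, hy b⟩) := by
    ext a b
    by_cases h : a = b <;> simp [M, SimpleGraph.adjMatrix_apply, hadj, h]
  rw [this]
  exact Matrix.rank_submatrix_le _ _ _

/-! ### Branches of a tree at an edge. -/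

namespace SimpleGraph

variable {V : Type*} {T : SimpleGraph V}

/-- The set of vertices reachable from `a` once the edge `ab` is removed. -/
def branch (T : SimpleGraph V) (a b : V) : Set V :=
  {t | (T.deleteEdges {s(a, b)}).Reachable a t}

theorem self_mem_branch (a b : V) : a ∈ T.branch a b := Reachable.refl _

theorem branch_induction {a b : V} {p : V → Prop} (ha : p a)
    (step : ∀ t u, t ∈ T.branch a b → u ∈ T.branch a b → T.Adj t u → s(t, u) ≠ s(a, b) → p t → p u)
    {t : V} (ht : t ∈ T.branch a b) : p t := by
  have h := (reachable_iff_reflTransGen _ _).1 ht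
  induction h with
  | refl => exact ha
  | tail h1 h2 ih =>
    have hb := (reachable_iff_reflTransGen _ _).2 h1
    have h3 := (deleteEdges_adj.1 h2)
    exact step _ _ hb ht h3.1 h3.2 (ih hb)

theorem mem_branch_of_adj {a b t u : V} (ht : t ∈ T.branch a b) (h : T.Adj t u)
    (hne : s(t, u) ≠ s(a, b)) : u ∈ T.branch a b :=
  Reachable.trans ht (Adj.reachable (deleteEdges_adj.2 ⟨h, hne⟩))

theorem IsAcyclic.notMem_branch (hT : T.IsAcyclic) {a b : V} (h : T.Adj a b) :
    b ∉ T.branch a b :=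
  isAcyclic_iff_forall_adj_isBridge.1 hT h

theorem Connected.mem_branch_or (hT : T.Connected) (a b t : V) :
    t ∈ T.branch a b ∨ t ∈ T.branch b a := by
  have h := (reachable_iff_reflTransGen _ _).1 (hT.preconnected a t)
  induction h with
  | refl => exact Or.inl (self_mem_branch _ _)
  | @tail t u h1 h2 ih =>
    by_cases he : s(t, u) = s(a, b)
    · rcases Sym2.eq_iff.1 he with ⟨-, rfl⟩ | ⟨-, rfl⟩
      · exact Or.inr (self_mem_branch _ _)
      · exact Or.inl (self_mem_branch _ _)
    · exact ih.imp (fun h => mem_branch_of_adj h h2 he)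
        fun h => mem_branch_of_adj h h2 (by rwa [Sym2.eq_swap (a := b)])

/-- Makes a smallest branch usable in `exists_balanced`: stepping past `a` away from `b` loses at
least `a`. -/
theorem IsAcyclic.branch_ssubset (hT : T.IsAcyclic) {a b c : V} (hc : T.Adj c a) (hcb : c ≠ b) :
    T.branch c a ⊂ T.branch a b := by
  have ha : a ∉ T.branch c a := hT.notMem_branch hc
  refine ⟨fun t ht => ?_, fun h => ha (h (self_mem_branch _ _))⟩
  refine branch_induction (p := (· ∈ T.branch a b)) ?_ ?_ ht
  · refine mem_branch_of_adj (self_mem_branch _ _) hc.symm fun h => ?_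
    rcases Sym2.eq_iff.1 h with ⟨-, h⟩ | ⟨-, h⟩
    · exact hcb h
    · exact hc.ne h
  · intro t u ht hu htu _ h
    refine mem_branch_of_adj h htu fun h => ?_
    rcases Sym2.eq_iff.1 h with ⟨rfl, -⟩ | ⟨-, rfl⟩
    · exact ha ht
    · exact ha hu

theorem exists_mem_branch_of_ne {a b t : V} (ht : t ∈ T.branch a b)
    (hta : t ≠ a) : ∃ c, T.Adj c a ∧ c ≠ b ∧ t ∈ T.branch c a := by
  revert hta
  refine branch_induction (p := fun t => t ≠ a → ∃ c, T.Adj c a ∧ c ≠ b ∧ t ∈ T.branch c a)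
    (fun h => absurd rfl h) ?_ ht
  intro t u ht hu htu hne ih hua
  by_cases hta : t = a
  · subst hta
    exact ⟨u, htu.symm, fun h => hne (by rw [h]), self_mem_branch _ _⟩
  · obtain ⟨c, hc, hcb, h⟩ := ih hta
    refine ⟨c, hc, hcb, mem_branch_of_adj h htu fun h' => ?_⟩
    rcases Sym2.eq_iff.1 h' with ⟨-, h'⟩ | ⟨h', -⟩
    · exact hua h'
    · exact hta h'

end SimpleGraph

/-! ### Balanced edges of a rank-decomposition. -/

open scoped Classical in
/-- Every rank-decomposition has a tree edge both of whose sides contain at least `m` elements of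
a given set of at least `3 * m` elements. -/
theorem RankDecomposition.exists_balanced {V : Type*} (D : RankDecomposition V) (W : Finset V)
    {m : ℕ} (hm : 1 ≤ m) (hW : 3 * m ≤ W.card) :
    ∃ d : D.tree.Dart, m ≤ (W.filter (· ∈ D.side d.fst d.snd)).card ∧
      m ≤ (W.filter (· ∉ D.side d.fst d.snd)).card := by
  have hac := D.isTree.isAcyclic
  have hsum : ∀ d : D.tree.Dart, (W.filter (· ∈ D.side d.fst d.snd)).card +
      (W.filter (· ∉ D.side d.fst d.snd)).card = W.card :=
    fun d => Finset.card_filter_add_card_filter_not _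
  by_contra! hcon
  obtain ⟨v, -⟩ : W.Nonempty := Finset.card_pos.1 (by omega)
  have hcompl : ∀ a b v, v ∉ D.side b a → v ∈ D.side a b := fun a b v hv =>
    (D.isTree.connected.mem_branch_or a b (D.leaf v).1).resolve_right hv
  have hflip : ∀ d : D.tree.Dart, m ≤ (W.filter (· ∈ D.side d.fst d.snd)).card ∨
      m ≤ (W.filter (· ∈ D.side d.snd d.fst)).card := by
    intro d
    by_contra! h
    have : (W.filter (· ∉ D.side d.fst d.snd)).card ≤ (W.filter (· ∈ D.side d.snd d.fst)).card :=
      Finset.card_le_card fun v hv => by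
        simp only [Finset.mem_filter] at hv ⊢
        exact ⟨hv.1, hcompl _ _ v hv.2⟩
    have := hsum d
    omega
  obtain ⟨d₀, hd₀⟩ : ∃ d : D.tree.Dart, m ≤ (W.filter (· ∈ D.side d.fst d.snd)).card := by
    have : 0 < D.tree.degree (D.leaf v).1 := by rw [(D.leaf v).2]; exact one_pos
    obtain ⟨b, hb⟩ := (D.tree.degree_pos_iff_exists_adj _).1 this
    rcases hflip ⟨(_, b), hb⟩ with h | h
    · exact ⟨_, h⟩
    · exact ⟨⟨(b, _), hb.symm⟩, h⟩
  -- Take a smallest branch holding at least `m` elements of `W`. Its sub-branches hold at most `m -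
  -- 1` each, while, no edge being balanced, it holds more than `2 * m` itself.
  obtain ⟨d, hd, hmin⟩ := Set.exists_min_image
    {d : D.tree.Dart | m ≤ (W.filter (· ∈ D.side d.fst d.snd)).card}
    (fun d => (D.tree.branch d.fst d.snd).ncard) (Set.toFinite _) ⟨d₀, hd₀⟩
  obtain ⟨⟨a, b⟩, hab⟩ := d
  simp only [Set.mem_ofPred_eq] at hd hmin
  change D.tree.Adj a b at hab
  have hsmall : ∀ c, D.tree.Adj c a → c ≠ b →
      (W.filter (· ∈ D.side c a)).card ≤ m - 1 := by
    intro c hc hcb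
    by_contra! h
    have h1 := hmin ⟨(c, a), hc⟩ (by simp only; omega)
    have h2 := Set.ncard_lt_ncard (hac.branch_ssubset hc hcb) (Set.toFinite _)
    simp only at h1
    omega
  have hbig := hsum ⟨(a, b), hab⟩
  have hcon' := hcon ⟨(a, b), hab⟩ hd
  simp only at hbig hcon'
  -- If `a` is a leaf, the branch is `a` alone and holds at most one element. Otherwise no element
  -- sits at `a`, and at most two sub-branches give at most `2 * (m - 1)`.
  by_cases hdeg : D.tree.degree a = 1
  · have hle : (W.filter (· ∈ D.side a b)).card ≤ 1 := by
      have key : ∀ v, v ∈ D.side a b → (D.leaf v).1 = a := by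
        intro v hv
        by_contra hne
        obtain ⟨c, hc, hcb, -⟩ := SimpleGraph.exists_mem_branch_of_ne hv hne
        have := (D.tree.degree_eq_one_iff_existsUnique_adj).1 hdeg
        exact hcb (this.unique hc.symm hab)
      refine Finset.card_le_one.2 fun v hv w hw => D.leaf.injective (Subtype.ext ?_)
      rw [key v (Finset.mem_filter.1 hv).2, key w (Finset.mem_filter.1 hw).2]
    omega
  · have hsub : W.filter (· ∈ D.side a b) ⊆
        ((D.tree.neighborFinset a).erase b).biUnion fun c => W.filter (· ∈ D.side c a) := by
      intro v hv
      obtain ⟨hvW, hv⟩ := Finset.mem_filter.1 hv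
      have hne : (D.leaf v).1 ≠ a := fun h => hdeg (h ▸ (D.leaf v).2)
      obtain ⟨c, hc, hcb, h⟩ := SimpleGraph.exists_mem_branch_of_ne hv hne
      simp only [Finset.mem_biUnion, Finset.mem_erase, SimpleGraph.mem_neighborFinset,
        Finset.mem_filter]
      exact ⟨c, ⟨hcb, hc.symm⟩, hvW, h⟩
    have h1 := (Finset.card_le_card hsub).trans (Finset.card_biUnion_le_card_mul _ _ (m - 1)
      fun c hc => by
        rw [Finset.mem_erase, SimpleGraph.mem_neighborFinset] at hc
        exact hsmall c hc.2.symm hc.1)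
    have h2 : ((D.tree.neighborFinset a).erase b).card ≤ 2 := by
      rw [Finset.card_erase_of_mem ((D.tree.mem_neighborFinset a b).2 hab),
        D.tree.card_neighborFinset_eq_degree]
      have := D.degree_le a
      omega
    have h3 := h1.trans (Nat.mul_le_mul_right (m - 1) h2)
    omega

/-! ### Existence of rank-decompositions, by caterpillars. -/

/-- The caterpillar with spine `(0, false), …, (N - 1, false)` and a leaf `(i, true)` attached to
each spine vertex. -/
def caterpillar (N : ℕ) : SimpleGraph (Fin N × Bool) where
  Adj x y := (x.1 = y.1 ∧ x.2 ≠ y.2) ∨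
    (x.2 = false ∧ y.2 = false ∧ (x.1.val + 1 = y.1.val ∨ y.1.val + 1 = x.1.val))
  symm := ⟨fun x y h => by grind⟩
  loopless := ⟨fun x h => by grind⟩

instance (N : ℕ) : DecidableRel (caterpillar N).Adj := fun x y =>
  inferInstanceAs (Decidable ((x.1 = y.1 ∧ x.2 ≠ y.2) ∨
    (x.2 = false ∧ y.2 = false ∧ (x.1.val + 1 = y.1.val ∨ y.1.val + 1 = x.1.val))))

theorem caterpillar_adj {N : ℕ} {x y : Fin N × Bool} :
    (caterpillar N).Adj x y ↔ (x.1 = y.1 ∧ x.2 ≠ y.2) ∨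
      (x.2 = false ∧ y.2 = false ∧ (x.1.val + 1 = y.1.val ∨ y.1.val + 1 = x.1.val)) := Iff.rfl

theorem caterpillar_connected {N : ℕ} (hN : 0 < N) : (caterpillar N).Connected := by
  have hspine : ∀ i (hi : i < N),
      (caterpillar N).Reachable (⟨0, hN⟩, false) (⟨i, hi⟩, false) := by
    intro i
    induction i with
    | zero => exact fun _ => SimpleGraph.Reachable.refl _
    | succ i ih =>
      exact fun hi => (ih (by omega)).trans
        (SimpleGraph.Adj.reachable (Or.inr ⟨rfl, rfl, Or.inl rfl⟩))
  have hroot : ∀ x, (caterpillar N).Reachable (⟨0, hN⟩, false) x := by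
    rintro ⟨i, b⟩
    cases b
    · exact hspine i.1 i.2
    · exact (hspine i.1 i.2).trans (SimpleGraph.Adj.reachable (Or.inl ⟨rfl, by simp⟩))
  have : Nonempty (Fin N × Bool) := ⟨(⟨0, hN⟩, false)⟩
  exact ⟨fun x y => (hroot x).symm.trans (hroot y)⟩

theorem caterpillar_isAcyclic (N : ℕ) : (caterpillar N).IsAcyclic := by
  rw [SimpleGraph.isAcyclic_iff_forall_adj_isBridge]
  -- Orient each edge from leaf to spine or up the spine. With the edge removed, the component of
  -- `x` is `x` alone, or stays at indices at most that of `x`.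
  have main : ∀ x y : Fin N × Bool, (x.1 = y.1 ∧ x.2 = true ∧ y.2 = false) ∨
      (x.2 = false ∧ y.2 = false ∧ x.1.val + 1 = y.1.val) →
      y ∉ (caterpillar N).branch x y := by
    rintro x y (⟨h1, h2, h3⟩ | ⟨h1, h2, h3⟩) hy
    · have := SimpleGraph.branch_induction (p := (· = x)) rfl (by
        rintro t u - - htu hne rfl
        refine absurd ?_ hne
        rw [caterpillar_adj] at htu
        have : u = y := by grind
        rw [this]) hy
      grind
    · have := SimpleGraph.branch_induction (p := fun t => t.1.val ≤ x.1.val) le_rfl (by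
        rintro t u - - htu hne ht
        by_contra hu
        rw [caterpillar_adj] at htu
        have h4 : t = x := by grind
        have h5 : u = y := by grind
        exact hne (by rw [h4, h5])) hy
      omega
  intro x y h
  have h' : y ∉ (caterpillar N).branch x y ∨ x ∉ (caterpillar N).branch y x := by
    rw [caterpillar_adj] at h
    by_cases hx : (x.1 = y.1 ∧ x.2 = true ∧ y.2 = false) ∨
      (x.2 = false ∧ y.2 = false ∧ x.1.val + 1 = y.1.val)
    · exact Or.inl (main x y hx)
    · exact Or.inr (main y x (by grind))
  rcases h' with h' | h'
  · exact h'
  · rw [Sym2.eq_swap]; exact h'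

theorem caterpillar_degree_true {N : ℕ} (i : Fin N) : (caterpillar N).degree (i, true) = 1 := by
  rw [SimpleGraph.degree_eq_one_iff_existsUnique_adj]
  exact ⟨(i, false), Or.inl ⟨rfl, by simp⟩, fun y hy => by
    rcases caterpillar_adj.1 hy with h | h
    · grind
    · simp at h⟩

theorem caterpillar_degree_false_ne {N : ℕ} (hN : 2 ≤ N) (i : Fin N) :
    (caterpillar N).degree (i, false) ≠ 1 := by
  rw [Ne, SimpleGraph.degree_eq_one_iff_existsUnique_adj]
  intro h
  have h1 : (caterpillar N).Adj (i, false) (i, true) := Or.inl ⟨rfl, by simp⟩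
  obtain ⟨j, hj⟩ : ∃ j : Fin N, i.val + 1 = j.val ∨ j.val + 1 = i.val := by
    by_cases hi : i.val + 1 < N
    · exact ⟨⟨i.val + 1, hi⟩, Or.inl rfl⟩
    · exact ⟨⟨i.val - 1, by omega⟩, Or.inr (by simp only; omega)⟩
  have h2 : (caterpillar N).Adj (i, false) (j, false) := Or.inr ⟨rfl, rfl, hj⟩
  simpa using congrArg Prod.snd (h.unique h1 h2)

theorem caterpillar_degree_le {N : ℕ} (x : Fin N × Bool) : (caterpillar N).degree x ≤ 3 := by
  rw [← SimpleGraph.card_neighborFinset_eq_degree]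
  -- There is at most one neighbour with a smaller, an equal and a larger index.
  have hinj : Set.InjOn (fun y : Fin N × Bool => if y.1.val < x.1.val then (0 : Fin 3)
      else if y.1.val = x.1.val then 1 else 2) ((caterpillar N).neighborFinset x) := by
    rintro ⟨j, b⟩ hy ⟨l, c⟩ hz h
    obtain ⟨i, a⟩ := x
    simp only [Finset.mem_coe, SimpleGraph.mem_neighborFinset, caterpillar_adj] at hy hz h
    simp only [Prod.mk.injEq, Fin.ext_iff] at hy hz ⊢
    cases a <;> cases b <;> cases c <;> split_ifs at h <;> simp_all <;> omega
  simpa using Finset.card_le_card_of_injOn _ (fun _ _ => Finset.mem_univ _) hinj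

/-- Needed because `sInf ∅ = 0`: a lower bound on all widths bounds `rankWidth` only if a
decomposition exists. -/
theorem nonempty_rankDecomposition {V : Type*} [Fintype V] (hV : 2 ≤ Fintype.card V) :
    Nonempty (RankDecomposition V) := by
  let N := Fintype.card V
  refine ⟨⟨Fin N × Bool, caterpillar N, ⟨caterpillar_connected (by omega),
    caterpillar_isAcyclic N⟩, caterpillar_degree_le, (Fintype.equivFin V).trans
    ⟨fun i => ⟨(i, true), caterpillar_degree_true i⟩, fun x => x.1.1, fun _ => rfl, ?_⟩⟩⟩
  rintro ⟨⟨i, b⟩, h⟩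
  cases b
  · exact absurd h (caterpillar_degree_false_ne hV i)
  · rfl

/-! ### Spokes and chords in the cocktail party graph. -/

theorem cocktailParty_adj {n : ℕ} {u v : Fin n × Bool} :
    (cocktailParty n).Adj u v ↔ u.1 ≠ v.1 := by
  rw [SimpleGraph.compl_adj]
  change u ≠ v ∧ ¬ (u.1 = v.1 ∧ u.2 ≠ v.2) ↔ _
  grind

/-- The edge joining `(i + 1, true)` to `(0, false)`. -/
def spoke {N : ℕ} (i : Fin N) : (cocktailParty (N + 1)).edgeSet :=
  ⟨s((i.succ, true), (0, false)), cocktailParty_adj.2 (Fin.succ_ne_zero i)⟩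

/-- The edge joining `(i + 1, false)` to `(j + 1, false)`. -/
def chord {N : ℕ} (i j : Fin N) (h : i ≠ j) : (cocktailParty (N + 1)).edgeSet :=
  ⟨s((i.succ, false), (j.succ, false)),
    cocktailParty_adj.2 fun h' => h (Fin.succ_injective _ h')⟩

theorem spoke_injective {N : ℕ} : Function.Injective (spoke (N := N)) := by
  intro i j h
  have := Subtype.ext_iff.1 h
  simpa [spoke] using this

theorem adj_chord_spoke {N : ℕ} (i j l : Fin N) (h : i ≠ j) :
    (edgeCliqueGraph (cocktailParty (N + 1))).Adj (chord i j h) (spoke l) ↔ l ≠ i ∧ l ≠ j := by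
  constructor
  · rintro ⟨-, s, hs, hc, hl⟩
    have h1 : (l.succ, true) ∈ s := hl _ (Sym2.mem_mk_left _ _)
    constructor
    · rintro rfl
      exact cocktailParty_adj.1 (hs h1 (hc (l.succ, false) (Sym2.mem_mk_left _ _)) (by simp)) rfl
    · rintro rfl
      exact cocktailParty_adj.1 (hs h1 (hc (l.succ, false) (Sym2.mem_mk_right _ _)) (by simp)) rfl
  · rintro ⟨hi, hj⟩
    refine ⟨fun h' => ?_, {(i.succ, false), (j.succ, false), (l.succ, true), (0, false)},
      ?_, ?_, ?_⟩
    · have := Subtype.ext_iff.1 h'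
      simp [chord, spoke] at this
    · intro u hu v hv huv
      rw [cocktailParty_adj]
      have := Fin.succ_injective N
      simp only [Set.mem_insert_iff, Set.mem_singleton_iff] at hu hv
      rcases hu with rfl | rfl | rfl | rfl <;> rcases hv with rfl | rfl | rfl | rfl <;>
        simp_all [Fin.succ_inj, eq_comm, Fin.succ_ne_zero]
    · intro v hv
      rcases Sym2.mem_iff.1 hv with rfl | rfl <;> simp
    · intro v hv
      rcases Sym2.mem_iff.1 hv with rfl | rfl <;> simp

/-- A cut of the edge-clique graph that splits the spokes has large cut-rank. -/
theorem le_cutRank_of_spokes {N m : ℕ} (hm : Even m)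
    (S : Set (cocktailParty (N + 1)).edgeSet) (X Y : Finset (Fin N))
    (hX : ∀ i ∈ X, spoke i ∈ S) (hY : ∀ j ∈ Y, spoke j ∉ S) (hXm : X.card = m)
    (hYm : Y.card = m) : m ≤ cutRank (edgeCliqueGraph (cocktailParty (N + 1))) S := by
  have hXY : ∀ i ∈ X, ∀ j ∈ Y, i ≠ j := fun i hi j hj h => hY j hj (h ▸ hX i hi)
  -- If some `j` has all its chords to `X` outside `S`, these face the spokes of `X`. Otherwise each
  -- `j` has a chord to some `f j` in `X` lying in `S`, and these face the spokes of `Y`; `f` need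
  -- not be injective, since `f j` is never in `Y`.
  by_cases h : ∃ j, ∃ hj : j ∈ Y, ∀ i (hi : i ∈ X), chord i j (hXY i hi j hj) ∉ S
  · obtain ⟨j, hj, h⟩ := h
    have := card_le_cutRank (κ := X) (edgeCliqueGraph (cocktailParty (N + 1))) S
      (by simpa [hXm] using hm) (fun i => spoke i.1)
      (fun i => chord i.1 j (hXY i i.2 j hj)) (fun i => hX i i.2) (fun i => h i i.2)
      (fun a b => by
        rw [SimpleGraph.adj_comm, adj_chord_spoke]
        exact ⟨fun h h' => h.1 (congrArg _ h'),
          fun h => ⟨fun h' => h (Subtype.ext h'), hXY a a.2 j hj⟩⟩)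
    simpa [hXm] using this
  · push Not at h
    choose f hf hfS using h
    have := card_le_cutRank (κ := Y) (edgeCliqueGraph (cocktailParty (N + 1))) S
      (by simpa [hYm] using hm)
      (fun j => chord (f j.1 j.2) j.1 (hXY _ (hf j.1 j.2) j j.2)) (fun j => spoke j.1)
      (fun j => hfS j.1 j.2) (fun j => hY j j.2)
      (fun a b => by
        rw [adj_chord_spoke]
        exact ⟨fun h h' => h.2 (congrArg _ h'.symm),
          fun h => ⟨(hXY _ (hf a.1 a.2) b b.2).symm, fun h' => h (Subtype.ext h'.symm)⟩⟩)
    simpa [hYm] using this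

open scoped Classical in
theorem le_width_edgeCliqueGraph {N m : ℕ} (hm : Even m) (h0 : 1 ≤ m) (hN : 3 * m ≤ N)
    (D : RankDecomposition (cocktailParty (N + 1)).edgeSet) :
    m ≤ D.width (edgeCliqueGraph (cocktailParty (N + 1))) := by
  obtain ⟨d, h1, h2⟩ := D.exists_balanced (Finset.univ.map ⟨spoke, spoke_injective⟩) h0
    (by simpa using hN)
  rw [Finset.filter_map, Finset.card_map] at h1 h2
  obtain ⟨X, hX, hXm⟩ := Finset.exists_subset_card_eq h1
  obtain ⟨Y, hY, hYm⟩ := Finset.exists_subset_card_eq h2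
  have h := le_cutRank_of_spokes hm (D.side d.fst d.snd) X Y
    (fun i hi => (Finset.mem_filter.1 (hX hi)).2) (fun j hj => (Finset.mem_filter.1 (hY hj)).2)
    hXm hYm
  refine h.trans ?_
  exact Finset.le_sup (f := fun d : D.tree.Dart =>
    cutRank (edgeCliqueGraph (cocktailParty (N + 1))) (D.side d.fst d.snd)) (Finset.mem_univ d)

theorem le_rankWidth_edgeCliqueGraph {N m : ℕ} (hm : Even m) (h0 : 1 ≤ m) (hN : 3 * m ≤ N) :
    m ≤ rankWidth (edgeCliqueGraph (cocktailParty (N + 1))) := by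
  have hcard : 2 ≤ Fintype.card (cocktailParty (N + 1)).edgeSet := by
    have := Fintype.card_le_of_injective _ (spoke_injective (N := N))
    rw [Fintype.card_fin] at this
    omega
  obtain ⟨D₀⟩ := nonempty_rankDecomposition hcard
  refine le_csInf ⟨_, D₀, rfl⟩ ?_
  rintro _ ⟨D, rfl⟩
  exact le_width_edgeCliqueGraph hm h0 hN D

theorem mainTheorem1 :
    ¬ ∃ k : ℕ, ∀ n : ℕ, rankWidth (edgeCliqueGraph (cocktailParty n)) ≤ k := by
  rintro ⟨k, hk⟩
  -- `m = 2 * (k + 1)` is even and exceeds `k`; `le_rfl` sets `N = 3 * m`.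
  have h := le_rankWidth_edgeCliqueGraph (even_two_mul (k + 1)) (by omega) le_rfl
  have := h.trans (hk _)
  omega
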